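/- Throughout, $S\subset\mathbb R^n_+=[0,\infty)^n$ is compact and convex with $0\in S$. Write $\mathbb C^{*}=\mathbb C\setminus\{0\}$, $\operatorname{Log} z=(\log|z_1|,\dots,\log|z_n|)$ for $z\in\mathbb C^{*n}$, and $\varphi_S(\xi)=\sup_{s\in S}\langle s,\xi\rangle$. Let $H_S(z)=\varphi_S(\operatorname{Log}z)$ for $z\in\mathbb C^{*n}$ and $H_S(z)=\limsup_{\mathbb C^{*n}\ni w\to z}H_S(w)$ for $z\in\mathbb C^n\setminus\mathbb C^{*n}$. Let $\mathcal L^S(\mathbb C^n)$ be the set of plurisubharmonic functions $u:\mathbb C^n\to[-\infty,\infty)$ such that $u\le H_S+c_u$ on $\mathbb C^n$ for some real constant $c_u$. For $m\in\mathbb N=\{0,1,2,\dots\}$ let $\mathcal P^S_m(\mathbb C^n)$ be the set of polynomials $p(z)=\sum_{\alpha\in (mS)\cap\mathbb N^n}a_\alpha z^\alpha$ with complex coefficients, and let $\mathcal P^S(\mathbb C^n)=\bigcup_{m}\mathcal P^S_m(\mathbb C^n)$. For a compact set $K\subset\mathbb C^n$ put $\|p\|_K=\sup_K|p|$ and, for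 $z\in\mathbb C^n$, $$V^S_K(z)=\sup\{u(z): u\in\mathcal L^S(\mathbb C^n),\ u|_K\le 0\},$$ $$\Phi^S_K(z)=\sup_{m\ge 1}\ \sup\{|p(z)|^{1/m}: p\in\mathcal P^S_m(\mathbb C^n),\ \|p\|_K\le 1\},$$ $$\widehat K^S=\{z\in\mathbb C^n: |p(z)|\le\|p\|_K\text{ for all }p\in\mathcal P^S(\mathbb C^n)\},$$ where $V^S_K$ and $\Phi^S_K$ may take the value $+\infty$. For an ordered subset $J=(j_1,\dots,j_\ell)$ of $\{1,\dots,n\}$ (distinct entries, $0\le\ell\le n$) let $\pi_J(z)=(z_{j_1},\dots,z_{j_\ell})$, $\mathbb C^J=\{z\in\mathbb C^n: z_k=0\text{ for all }k\notin J\}$, $\mathbb R^J=\mathbb C^J\cap\mathbb R^n$, $S_J=\pi_J(S\cap\mathbb R^J)\subset\mathbb R^\ell_+$ and $K_J=\pi_J(K)\subset\mathbb C^\ell$. **Proposition.** Let $K\subset\mathbb C^n$ be a compact Reinhardt set, that is, a compact set such that $(\zeta_1z_1,\dots,\zeta_nz_n)\in K$ whenever $z\in K$ and $|\zeta_1|=\dots=|\zeta_n|=1$.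 For every ordered subset $J\subset\{1,\dots,n\}$ and every $z\in\mathbb C^J$, $$V^S_K(z)=V^{S_J}_{K_J}(\pi_J(z))\qquad\text{and}\qquad \Phi^S_K(z)=\Phi^{S_J}_{K_J}(\pi_J(z)).$$ Furthermore, $\pi_J(\widehat K^S\cap\mathbb C^J)=\widehat{K_J}^{\,S_J}$. -/

import Mathlib

open scoped Pointwise Topology

noncomputable section

namespace SiciakZakharyuta

/-- `ℂ*ⁿ`: the points of `ℂⁿ` none of whose coordinates vanishes. -/
def punctured (n : ℕ) : Set (Fin n → ℂ) := {z | ∀ i, z i ≠ 0}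

/-- `Log z = (log |z₁|, …, log |zₙ|)`; only used on `ℂ*ⁿ`. -/
def logAbs {n : ℕ} (z : Fin n → ℂ) : Fin n → ℝ := fun i => Real.log ‖z i‖

/-- The supporting function `φ_S(ξ) = sup_{s ∈ S} ⟨s, ξ⟩`, as an extended real. -/
def supportFun {n : ℕ} (S : Set (Fin n → ℝ)) (ξ : Fin n → ℝ) : EReal :=
  ⨆ s ∈ S, ((∑ i, s i * ξ i : ℝ) : EReal)

open Classical in
/-- The logarithmic supporting function `H_S`: it is `φ_S (Log z)` on `ℂ*ⁿ`, and the upper limit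
of these values along `ℂ*ⁿ` at the other points. -/
def logSupport {n : ℕ} (S : Set (Fin n → ℝ)) (z : Fin n → ℂ) : EReal :=
  if z ∈ punctured n then supportFun S (logAbs z)
  else Filter.limsup (fun w => supportFun S (logAbs w)) (𝓝[punctured n] z)

/-- The extended integral `∫₀¹ f(t) dt` of an extended real valued function, as the integral of the
positive part minus that of the negative part (meaningful when one of the two is finite, as for
upper semicontinuous `f : ℝ → [-∞, ∞)`). -/
def unitIntegral (f : ℝ → EReal) : EReal :=
  ((∫⁻ t in Set.Icc (0 : ℝ) 1, (f t).toENNReal : ENNReal) : EReal) -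
    ((∫⁻ t in Set.Icc (0 : ℝ) 1, (-f t).toENNReal : ENNReal) : EReal)

/-- Plurisubharmonic functions `ℂⁿ → [-∞, ∞)`: upper semicontinuous, with the sub-mean value
property on every circle of every complex line. The constant `-∞` is allowed. -/
structure IsPSH {n : ℕ} (u : (Fin n → ℂ) → EReal) : Prop where
  lt_top : ∀ z, u z < ⊤
  usc : UpperSemicontinuous u
  le_mean : ∀ a b : Fin n → ℂ,
    u a ≤ unitIntegral fun t => u (a + Complex.exp (2 * Real.pi * Complex.I * t) • b)

/-- The class `𝓛^S(ℂⁿ)`: plurisubharmonic `u` with `u ≤ H_S + c` for some real constant `c`. -/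
def lelongClass {n : ℕ} (S : Set (Fin n → ℝ)) : Set ((Fin n → ℂ) → EReal) :=
  {u | IsPSH u ∧ ∃ c : ℝ, ∀ z, u z ≤ logSupport S z + (c : EReal)}

/-- The Siciak-Zakharyuta function `V^S_K(z) = sup {u(z) ; u ∈ 𝓛^S(ℂⁿ), u|_K ≤ 0}`. -/
def extremalFun {n : ℕ} (S : Set (Fin n → ℝ)) (K : Set (Fin n → ℂ)) (z : Fin n → ℂ) : EReal :=
  ⨆ u ∈ {u | u ∈ lelongClass S ∧ ∀ w ∈ K, u w ≤ 0}, u z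

/-- `𝓟^S_m(ℂⁿ)`: the polynomials all of whose exponents lie in `mS`. -/
def polySpace {n : ℕ} (S : Set (Fin n → ℝ)) (m : ℕ) : Set (MvPolynomial (Fin n) ℂ) :=
  {p | ∀ α ∈ p.support, (fun i => (α i : ℝ)) ∈ (m : ℝ) • S}

/-- `‖p‖_K = sup_K |p|`, in `[0, ∞]`. -/
def supNormOn {n : ℕ} (K : Set (Fin n → ℂ)) (p : MvPolynomial (Fin n) ℂ) : ENNReal :=
  ⨆ w ∈ K, ‖MvPolynomial.eval w p‖ₑ

/-- The `m`-th Siciak function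
`Φ^S_{K,m}(z) = sup {|p(z)|^{1/m} ; p ∈ 𝓟^S_m(ℂⁿ), ‖p‖_K ≤ 1}`, for `m ≥ 1`. -/
def siciakFunOf {n : ℕ} (S : Set (Fin n → ℝ)) (K : Set (Fin n → ℂ)) (m : ℕ)
    (z : Fin n → ℂ) : ENNReal :=
  ⨆ p ∈ {p | p ∈ polySpace S m ∧ supNormOn K p ≤ 1},
    ‖MvPolynomial.eval z p‖ₑ ^ (1 / (m : ℝ))

/-- The Siciak function `Φ^S_K = sup_{m ≥ 1} Φ^S_{K,m}`. -/
def siciakFun {n : ℕ} (S : Set (Fin n → ℝ)) (K : Set (Fin n → ℂ)) (z : Fin n → ℂ) : ENNReal :=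
  ⨆ m ∈ {m : ℕ | 1 ≤ m}, siciakFunOf S K m z

/-- The `S`-hull of `K`: the `z` with `|p(z)| ≤ ‖p‖_K` for all `p ∈ 𝓟^S(ℂⁿ) = ⋃ₘ 𝓟^S_m(ℂⁿ)`. -/
def hull {n : ℕ} (S : Set (Fin n → ℝ)) (K : Set (Fin n → ℂ)) : Set (Fin n → ℂ) :=
  {z | ∀ p ∈ ⋃ m : ℕ, polySpace S m, ‖MvPolynomial.eval z p‖ₑ ≤ supNormOn K p}

/-- Reinhardt sets: invariant under coordinatewise rotation by the unit torus. -/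
def IsReinhardt {n : ℕ} (K : Set (Fin n → ℂ)) : Prop :=
  ∀ z ∈ K, ∀ ζ : Fin n → ℂ, (∀ i, ‖ζ i‖ = 1) → (fun i => ζ i * z i) ∈ K

/-- `π_J(z) = (z_{j₁}, …, z_{j_ℓ})` for `J = (j₁, …, j_ℓ)` with distinct entries. -/
def proj {n l : ℕ} {R : Type*} (J : Fin l ↪ Fin n) (z : Fin n → R) : Fin l → R :=
  fun i => z (J i)

/-- `R^J`: the points of `Rⁿ` whose coordinates outside `J` vanish (`R = ℂ` or `ℝ`). -/
def coordSubspace {n l : ℕ} (R : Type*) [Zero R] (J : Fin l ↪ Fin n) : Set (Fin n → R) :=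
  {z | ∀ k, k ∉ Set.range J → z k = 0}

/-- `S_J = π_J(S ∩ ℝ^J)`. -/
def face {n l : ℕ} (J : Fin l ↪ Fin n) (S : Set (Fin n → ℝ)) : Set (Fin l → ℝ) :=
  proj J '' (S ∩ coordSubspace ℝ J)

end SiciakZakharyuta

end

/-! For `z ∈ ℂ^J` the value `H_S(z)` is the supremum of `log |z^s|` over the `s ∈ S ∩ ℝ^J` alone,
because every other `s` gives `-∞`. Hence extension by zero and `π_J` carry `𝓛^S` and `𝓟^S_m` to
`𝓛^{S_J}` and `𝓟^{S_J}_m` and back. If `K` is Reinhardt and `w ∈ K`, rotating the coordinates of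
`w` outside `J` simultaneously traces a circle in `K` centred at the projection of `w` to `ℂ^J`, so
by the sub-mean value property and the maximum principle a bound on `K` persists at the centre. -/

open Filter

open scoped ENNReal

namespace SiciakZakharyuta

variable {n l : ℕ}

section CoordinateInclusion

variable {R : Type*} [Semiring R] {J : Fin l ↪ Fin n}

/-- The linear embedding `Rˡ → Rⁿ` with image `R^J` that inverts `π_J` there (`R = ℂ` or `ℝ`):
it puts the `i`-th coordinate at place `J i` and zeros elsewhere. -/
noncomputable def incl (R : Type*) [Semiring R] (J : Fin l ↪ Fin n) :
    (Fin l → R) →ₗ[R] (Fin n → R) :=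
  Function.ExtendByZero.linearMap R J

lemma incl_apply (x : Fin l → R) (i : Fin l) : incl R J x (J i) = x i :=
  J.injective.extend_apply _ _ _

lemma incl_apply_of_notMem_range (x : Fin l → R) {k : Fin n} (hk : k ∉ Set.range J) :
    incl R J x k = 0 :=
  Function.extend_apply' _ _ _ hk

lemma proj_incl (x : Fin l → R) : proj J (incl R J x) = x :=
  funext (incl_apply x)

lemma incl_injective : Function.Injective (incl R J) :=
  Function.LeftInverse.injective proj_incl

lemma incl_mem_coordSubspace (x : Fin l → R) : incl R J x ∈ coordSubspace R J :=
  fun _ => incl_apply_of_notMem_range x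

lemma incl_eq_of_mem_coordSubspace {x : Fin l → R} {y : Fin n → R} (hy : y ∈ coordSubspace R J)
    (h : ∀ i, x i = y (J i)) : incl R J x = y := by
  ext k
  by_cases hk : k ∈ Set.range J
  · obtain ⟨i, rfl⟩ := hk
    rw [incl_apply, h]
  · rw [incl_apply_of_notMem_range x hk, hy k hk]

lemma incl_proj {y : Fin n → R} (hy : y ∈ coordSubspace R J) : incl R J (proj J y) = y :=
  incl_eq_of_mem_coordSubspace hy fun _ => rfl

lemma image_proj_inter_coordSubspace (A : Set (Fin n → R)) :
    proj J '' (A ∩ coordSubspace R J) = incl R J ⁻¹' A := by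
  ext x
  constructor
  · rintro ⟨y, ⟨hyA, hyJ⟩, rfl⟩
    rwa [Set.mem_preimage, incl_proj hyJ]
  · intro hx
    exact ⟨incl R J x, ⟨hx, incl_mem_coordSubspace x⟩, proj_incl x⟩

lemma face_eq_preimage_incl (S : Set (Fin n → ℝ)) : face J S = incl ℝ J ⁻¹' S :=
  image_proj_inter_coordSubspace S

lemma isCompact_face {S : Set (Fin n → ℝ)} (hS : IsCompact S) : IsCompact (face J S) := by
  rw [face_eq_preimage_incl]
  exact (LinearMap.isClosedEmbedding_of_injective
    (LinearMap.ker_eq_bot.mpr incl_injective)).isCompact_preimage hS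

lemma nonneg_of_mem_face {S : Set (Fin n → ℝ)} (hS : ∀ s ∈ S, ∀ i, 0 ≤ s i) :
    ∀ s ∈ face J S, ∀ i, 0 ≤ s i := by
  rintro _ ⟨s, ⟨hs, -⟩, rfl⟩ i
  exact hS s hs (J i)

lemma mem_smul_face_iff {S : Set (Fin n → ℝ)} {r : ℝ} (h : r ≠ 0 ∨ (face J S).Nonempty)
    {s : Fin l → ℝ} : s ∈ r • face J S ↔ incl ℝ J s ∈ r • S := by
  rcases eq_or_ne r 0 with rfl | hr
  · have hface : (face J S).Nonempty := h.resolve_left (not_not.mpr rfl)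
    have hS : S.Nonempty := hface.of_image.mono Set.inter_subset_left
    rw [Set.zero_smul_set hface, Set.zero_smul_set hS, Set.mem_zero, Set.mem_zero,
      map_eq_zero_iff _ incl_injective]
  · rw [Set.mem_smul_set_iff_inv_smul_mem₀ hr, Set.mem_smul_set_iff_inv_smul_mem₀ hr,
      face_eq_preimage_incl, Set.mem_preimage, map_smul]

end CoordinateInclusion

section Semicontinuity

variable {X Y γ : Type*} [TopologicalSpace X] [TopologicalSpace Y]

lemma upperSemicontinuous_iSup_of_isCompact [CompleteLinearOrder γ] [DenselyOrdered γ]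
    {f : X × Y → γ} {A : Set Y} (hA : IsCompact A)
    (hf : UpperSemicontinuousOn f (Set.univ ×ˢ A)) :
    UpperSemicontinuous fun x => ⨆ y ∈ A, f (x, y) := by
  intro x c hc
  obtain ⟨r, hr, hrc⟩ := exists_between hc
  have hlt : ∀ᶠ x' in 𝓝 x, ∀ y ∈ A, y ∈ A → f (x', y) < r := by
    refine hA.eventually_forall_of_forall_eventually fun y hy => ?_
    have hxy : f (x, y) < r := (le_iSup₂ (f := fun y (_ : y ∈ A) => f (x, y)) y hy).trans_lt hr
    filter_upwards [eventually_nhdsWithin_iff.mp (hf (x, y) ⟨trivial, hy⟩ r hxy)] with p hp hpA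
    exact hp ⟨trivial, hpA⟩
  filter_upwards [hlt] with x' hx'
  exact (iSup₂_le fun y hy => (hx' y hy hy).le).trans_lt hrc

variable {ι : Type*} {t : Finset ι} {f : ι → X → EReal} {A : Set X} {x : X}

lemma sum_ne_top {a : ι → EReal} (ha : ∀ i ∈ t, a i ≠ ⊤) : ∑ i ∈ t, a i ≠ ⊤ :=
  Finset.sum_induction a (· ≠ ⊤) (fun _ _ => EReal.add_ne_top) EReal.zero_ne_top ha

lemma continuousAt_sum (hf : ∀ i ∈ t, ContinuousAt (f i) x) (htop : ∀ i ∈ t, f i x ≠ ⊤) :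
    ContinuousAt (fun y => ∑ i ∈ t, f i y) x := by
  classical
  induction t using Finset.induction_on with
  | empty => simpa using continuousAt_const
  | insert j t hj ih =>
    rw [Finset.forall_mem_insert] at hf htop
    simp only [Finset.sum_insert hj]
    exact ContinuousAt.comp₂ (f := fun p : EReal × EReal => p.1 + p.2)
      (EReal.continuousAt_add (.inl htop.1) (.inr (sum_ne_top htop.2))) hf.1 (ih hf.2 htop.2)

lemma upperSemicontinuousWithinAt_sum_of_ne_top
    (hf : ∀ i ∈ t, UpperSemicontinuousWithinAt (f i) A x) (htop : ∀ i ∈ t, f i x ≠ ⊤) :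
    UpperSemicontinuousWithinAt (fun y => ∑ i ∈ t, f i y) A x := by
  classical
  induction t using Finset.induction_on with
  | empty => simpa using upperSemicontinuousWithinAt_const
  | insert j t hj ih =>
    rw [Finset.forall_mem_insert] at hf htop
    simp only [Finset.sum_insert hj]
    exact hf.1.add' (ih hf.2 htop.2)
      (EReal.continuousAt_add (.inl htop.1) (.inr (sum_ne_top htop.2)))

lemma upperSemicontinuousWithinAt_mul_log {g : X → ℝ} {h : X → ℝ≥0∞}
    (hg : ContinuousWithinAt g A x) (hh : ContinuousWithinAt h A x) (hnonneg : ∀ y ∈ A, 0 ≤ g y)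
    (htop : h x ≠ ⊤) :
    UpperSemicontinuousWithinAt (fun y => (g y : EReal) * (h y).log) A x := by
  have hlog : (h x).log ≠ ⊤ := by simpa using htop
  by_cases h0 : g x = 0 ∧ h x = 0
  · -- The product is discontinuous at `(0, 0)`, but nonpositive as soon as `h ≤ 1`.
    intro c hc
    have hc : 0 < c := by simpa [h0.1] using hc
    filter_upwards [hh.eventually_lt_const (u := 1) (by simp [h0.2]), self_mem_nhdsWithin]
      with y hy hyA
    refine lt_of_le_of_lt ?_ hc
    exact mul_nonpos_of_nonneg_of_nonpos (EReal.coe_nonneg.mpr (hnonneg y hyA))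
      (ENNReal.log_le_zero_iff.mpr hy.le)
  · refine ContinuousWithinAt.upperSemicontinuousWithinAt ?_
    have hbot : (g x : EReal) ≠ 0 ∨ (h x).log ≠ ⊥ := by
      simpa only [ne_eq, EReal.coe_eq_zero, ENNReal.log_eq_bot_iff, not_and_or] using h0
    exact EReal.Tendsto.mul ((continuous_coe_real_ereal.tendsto _).comp hg)
      ((ENNReal.continuous_log.tendsto _).comp hh) hbot (.inr hlog)
      (.inl (EReal.coe_ne_bot _)) (.inl (EReal.coe_ne_top _))

end Semicontinuity

section LogSupport

/-- `log |z^s| = ∑ᵢ sᵢ log |zᵢ|` at every `z ∈ ℂⁿ`, with `log 0 = -∞` and `0 · log 0 = 0`. -/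
noncomputable def logMonomial (s : Fin n → ℝ) (z : Fin n → ℂ) : EReal :=
  ∑ i, (s i : EReal) * ENNReal.log ‖z i‖ₑ

variable {S : Set (Fin n → ℝ)} {J : Fin l ↪ Fin n}

lemma coe_mul_log_enorm_ne_top {r : ℝ} (hr : 0 ≤ r) (w : ℂ) :
    (r : EReal) * ENNReal.log ‖w‖ₑ ≠ ⊤ := by
  rw [← ENNReal.log_rpow, Ne, ENNReal.log_eq_top_iff]
  exact ENNReal.rpow_ne_top_of_nonneg hr enorm_ne_top

lemma logMonomial_of_mem_punctured (s : Fin n → ℝ) {z : Fin n → ℂ} (hz : z ∈ punctured n) :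
    logMonomial s z = ((∑ i, s i * logAbs z i : ℝ) : EReal) := by
  have hsum (a : Fin n → ℝ) : ((∑ i, a i : ℝ) : EReal) = ∑ i, (a i : EReal) :=
    map_sum (⟨⟨Real.toEReal, EReal.coe_zero⟩, EReal.coe_add⟩ : ℝ →+ EReal) a _
  rw [hsum, logMonomial]
  refine Finset.sum_congr rfl fun i _ => ?_
  rw [EReal.coe_mul, logAbs, ← ofReal_norm,
    ENNReal.log_ofReal_of_pos (norm_pos_iff.mpr (hz i))]

lemma logMonomial_eq_bot {s : Fin n → ℝ} {z : Fin n → ℂ} {k : Fin n} (hs : 0 < s k)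
    (hz : z k = 0) : logMonomial s z = ⊥ := by
  rw [logMonomial, ← Finset.add_sum_erase _ _ (Finset.mem_univ k), hz, enorm_zero,
    ENNReal.log_zero, EReal.coe_mul_bot_of_pos hs, EReal.bot_add]

lemma logMonomial_incl (s : Fin l → ℝ) (z : Fin n → ℂ) :
    logMonomial (incl ℝ J s) z = logMonomial s (proj J z) := by
  refine (Finset.sum_of_injOn J J.injective.injOn (by simp) (fun k _ hk => ?_) fun i _ => ?_).symm
  · rw [incl_apply_of_notMem_range s (by simpa using hk), EReal.coe_zero, zero_mul]
  · rw [incl_apply, proj]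

lemma continuous_logMonomial {s : Fin n → ℝ} (hs : ∀ i, 0 ≤ s i) :
    Continuous (logMonomial s) := by
  refine continuous_iff_continuousAt.mpr fun z => continuousAt_sum (fun i _ => ?_)
    fun i _ => coe_mul_log_enorm_ne_top (hs i) (z i)
  have hlog : Continuous fun w : Fin n → ℂ => ENNReal.log ‖w i‖ₑ :=
    ENNReal.continuous_log.comp (continuous_apply i).enorm
  exact EReal.Tendsto.const_mul hlog.continuousAt (.inl (EReal.coe_ne_bot _))
    (.inl (EReal.coe_ne_top _))

lemma upperSemicontinuousOn_logMonomial :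
    UpperSemicontinuousOn (fun p : (Fin n → ℂ) × (Fin n → ℝ) => logMonomial p.2 p.1)
      {p | ∀ i, 0 ≤ p.2 i} := by
  intro p hp
  refine upperSemicontinuousWithinAt_sum_of_ne_top (fun i _ => ?_)
    fun i _ => coe_mul_log_enorm_ne_top (hp i) (p.1 i)
  have hcoeff : Continuous fun q : (Fin n → ℂ) × (Fin n → ℝ) => q.2 i := by fun_prop
  have hnorm : Continuous fun q : (Fin n → ℂ) × (Fin n → ℝ) => ‖q.1 i‖ₑ := by fun_prop
  exact upperSemicontinuousWithinAt_mul_log hcoeff.continuousWithinAt hnorm.continuousWithinAt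
    (fun q hq => hq i) enorm_ne_top

lemma dense_punctured (n : ℕ) : Dense (punctured n) := by
  have h : punctured n = Set.univ.pi fun _ => {0}ᶜ := by
    ext z
    simp [punctured]
  rw [h]
  exact dense_pi _ fun _ _ => dense_compl_singleton 0

lemma supportFun_logAbs (S : Set (Fin n → ℝ)) {z : Fin n → ℂ} (hz : z ∈ punctured n) :
    supportFun S (logAbs z) = ⨆ s ∈ S, logMonomial s z := by
  simp only [supportFun, logMonomial_of_mem_punctured _ hz]

lemma logSupport_eq_iSup_logMonomial (hScomp : IsCompact S) (hS : ∀ s ∈ S, ∀ i, 0 ≤ s i)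
    (z : Fin n → ℂ) : logSupport S z = ⨆ s ∈ S, logMonomial s z := by
  unfold logSupport
  split_ifs with hz
  · exact supportFun_logAbs S hz
  have hne : (𝓝[punctured n] z).NeBot :=
    mem_closure_iff_nhdsWithin_neBot.mp (dense_punctured n z)
  have hcongr : (fun w => supportFun S (logAbs w)) =ᶠ[𝓝[punctured n] z]
      fun w => ⨆ s ∈ S, logMonomial s w := by
    filter_upwards [self_mem_nhdsWithin] with w hw using supportFun_logAbs S hw
  rw [limsup_congr hcongr]
  refine le_antisymm ?_ (iSup₂_le fun s hs => ?_)
  · have husc : UpperSemicontinuous fun w => ⨆ s ∈ S, logMonomial s w :=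
      upperSemicontinuous_iSup_of_isCompact hScomp
        (upperSemicontinuousOn_logMonomial.mono fun p hp => hS p.2 hp.2)
    exact (limsup_le_limsup_of_le nhdsWithin_le_nhds).trans (husc.limsup_le z)
  · have hlim : Tendsto (logMonomial s) (𝓝[punctured n] z) (𝓝 (logMonomial s z)) :=
      (continuous_logMonomial (hS s hs)).continuousWithinAt
    rw [← hlim.limsup_eq]
    exact limsup_le_limsup (.of_forall fun w => le_iSup₂_of_le s hs le_rfl)

lemma logSupport_face_proj_le (hScomp : IsCompact S) (hS : ∀ s ∈ S, ∀ i, 0 ≤ s i)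
    (z : Fin n → ℂ) : logSupport (face J S) (proj J z) ≤ logSupport S z := by
  rw [logSupport_eq_iSup_logMonomial (isCompact_face hScomp) (nonneg_of_mem_face hS),
    logSupport_eq_iSup_logMonomial hScomp hS, face_eq_preimage_incl]
  refine iSup₂_le fun s hs => ?_
  rw [← logMonomial_incl]
  exact le_iSup₂_of_le (incl ℝ J s) hs le_rfl

lemma logSupport_incl_le (hScomp : IsCompact S) (hS : ∀ s ∈ S, ∀ i, 0 ≤ s i)
    (ζ : Fin l → ℂ) : logSupport S (incl ℂ J ζ) ≤ logSupport (face J S) ζ := by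
  rw [logSupport_eq_iSup_logMonomial (isCompact_face hScomp) (nonneg_of_mem_face hS),
    logSupport_eq_iSup_logMonomial hScomp hS]
  refine iSup₂_le fun s hs => ?_
  by_cases hsJ : s ∈ coordSubspace ℝ J
  · refine le_iSup₂_of_le (proj J s) ⟨s, ⟨hs, hsJ⟩, rfl⟩ ?_
    rw [← incl_proj hsJ, logMonomial_incl, proj_incl, proj_incl]
  · obtain ⟨k, hk, hsk⟩ : ∃ k, k ∉ Set.range J ∧ s k ≠ 0 := by
      simpa [coordSubspace] using hsJ
    rw [logMonomial_eq_bot ((hS s hs k).lt_of_ne' hsk) (incl_apply_of_notMem_range ζ hk)]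
    exact bot_le

end LogSupport

section Reinhardt

variable {K : Set (Fin n → ℂ)} {J : Fin l ↪ Fin n}

lemma IsReinhardt.incl_proj_add_smul_mem (hK : IsReinhardt K) {z : Fin n → ℂ} (hz : z ∈ K) {c : ℂ}
    (hc : ‖c‖ = 1) : incl ℂ J (proj J z) + c • (z - incl ℂ J (proj J z)) ∈ K := by
  classical
  convert! hK z hz (fun k => if k ∈ Set.range J then 1 else c)
    (fun k => by split_ifs <;> simp [hc]) using 1
  ext k
  by_cases hk : k ∈ Set.range J
  · obtain ⟨i, rfl⟩ := hk
    simp [incl_apply, proj]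
  · simp only [Pi.add_apply, Pi.smul_apply, Pi.sub_apply, incl_apply_of_notMem_range _ hk,
      if_neg hk, zero_add, sub_zero, smul_eq_mul]

end Reinhardt

section Plurisubharmonic

variable {S : Set (Fin n → ℝ)} {K : Set (Fin n → ℂ)} {J : Fin l ↪ Fin n}

lemma IsPSH.comp_linearMap {u : (Fin n → ℂ) → EReal} (hu : IsPSH u)
    (L : (Fin l → ℂ) →ₗ[ℂ] (Fin n → ℂ)) : IsPSH fun ζ => u (L ζ) where
  lt_top ζ := hu.lt_top _
  usc := hu.usc.comp L.continuous_of_finiteDimensional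
  le_mean a b := by simpa only [map_add, map_smul] using hu.le_mean (L a) (L b)

lemma unitIntegral_nonpos {f : ℝ → EReal} (hf : ∀ t, f t ≤ 0) : unitIntegral f ≤ 0 := by
  simp only [unitIntegral, EReal.toENNReal_of_nonpos (hf _), MeasureTheory.lintegral_zero]
  rw [EReal.coe_ennreal_zero, zero_sub, EReal.neg_le, neg_zero]
  exact EReal.coe_ennreal_nonneg _

lemma IsPSH.nonpos_of_circle {u : (Fin n → ℂ) → EReal} (hu : IsPSH u) {a b : Fin n → ℂ}
    (h : ∀ c : ℂ, ‖c‖ = 1 → u (a + c • b) ≤ 0) : u a ≤ 0 := by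
  refine (hu.le_mean a b).trans (unitIntegral_nonpos fun t => h _ ?_)
  simp [Complex.norm_exp]

lemma IsPSH.incl_proj_nonpos {u : (Fin n → ℂ) → EReal} (hu : IsPSH u) (hK : IsReinhardt K)
    (huK : ∀ w ∈ K, u w ≤ 0) {w : Fin n → ℂ} (hw : w ∈ K) : u (incl ℂ J (proj J w)) ≤ 0 :=
  hu.nonpos_of_circle fun _ hc => huK _ (hK.incl_proj_add_smul_mem hw hc)

lemma comp_incl_mem_lelongClass (hScomp : IsCompact S) (hS : ∀ s ∈ S, ∀ i, 0 ≤ s i)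
    {u : (Fin n → ℂ) → EReal} (hu : u ∈ lelongClass S) :
    (fun ζ => u (incl ℂ J ζ)) ∈ lelongClass (face J S) := by
  obtain ⟨hpsh, c, hc⟩ := hu
  exact ⟨hpsh.comp_linearMap _, c,
    fun ζ => (hc _).trans (add_le_add_left (logSupport_incl_le hScomp hS ζ) _)⟩

lemma comp_proj_mem_lelongClass (hScomp : IsCompact S) (hS : ∀ s ∈ S, ∀ i, 0 ≤ s i)
    {v : (Fin l → ℂ) → EReal} (hv : v ∈ lelongClass (face J S)) :
    (fun z => v (proj J z)) ∈ lelongClass S := by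
  obtain ⟨hpsh, c, hc⟩ := hv
  exact ⟨hpsh.comp_linearMap (LinearMap.funLeft ℂ ℂ J), c,
    fun z => (hc _).trans (add_le_add_left (logSupport_face_proj_le hScomp hS z) _)⟩

lemma le_extremalFun {u : (Fin n → ℂ) → EReal} (hu : u ∈ lelongClass S) (huK : ∀ w ∈ K, u w ≤ 0)
    (z : Fin n → ℂ) : u z ≤ extremalFun S K z :=
  le_iSup₂_of_le (f := fun u (_ : u ∈ {u | u ∈ lelongClass S ∧ ∀ w ∈ K, u w ≤ 0}) => u z)
    u ⟨hu, huK⟩ le_rfl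

theorem extremalFun_incl (hScomp : IsCompact S) (hS : ∀ s ∈ S, ∀ i, 0 ≤ s i)
    (hK : IsReinhardt K) (ζ : Fin l → ℂ) :
    extremalFun S K (incl ℂ J ζ) = extremalFun (face J S) (proj J '' K) ζ := by
  refine le_antisymm (iSup₂_le fun u ⟨hu, huK⟩ => ?_) (iSup₂_le fun v ⟨hv, hvK⟩ => ?_)
  · exact le_extremalFun (comp_incl_mem_lelongClass hScomp hS hu)
      (Set.forall_mem_image.mpr fun w hw => hu.1.incl_proj_nonpos hK huK hw) ζ
  · have h := le_extremalFun (comp_proj_mem_lelongClass hScomp hS hv)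
      (fun w hw => hvK _ (Set.mem_image_of_mem _ hw)) (incl ℂ J ζ)
    rwa [proj_incl] at h

end Plurisubharmonic

section Polynomial

open MvPolynomial

variable {S : Set (Fin n → ℝ)} {K : Set (Fin n → ℂ)} {J : Fin l ↪ Fin n}

lemma enorm_apply_le_of_circle {E F : Type*} [NormedAddCommGroup E] [NormedSpace ℂ E]
    [NormedAddCommGroup F] [NormedSpace ℂ F] {f : E → F} (hf : Differentiable ℂ f) {a b : E}
    {C : ℝ≥0∞} (h : ∀ c : ℂ, ‖c‖ = 1 → ‖f (a + c • b)‖ₑ ≤ C) : ‖f a‖ₑ ≤ C := by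
  induction C with
  | top => exact le_top
  | coe C =>
    simp only [enorm_le_coe, ← NNReal.coe_le_coe, coe_nnnorm] at h ⊢
    have hline : Differentiable ℂ fun c : ℂ => f (a + c • b) := by fun_prop
    have hle := Complex.norm_le_of_forall_mem_frontier_norm_le Metric.isBounded_ball
      hline.diffContOnCl (U := Metric.ball 0 1) (C := C)
      (fun c hc => h c (by simpa [frontier_ball] using hc))
      (subset_closure (Metric.mem_ball_self one_pos))
    simpa using hle

lemma differentiable_eval (p : MvPolynomial (Fin n) ℂ) :
    Differentiable ℂ fun z : Fin n → ℂ => eval z p :=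
  fun z => (AnalyticOnNhd.eval_mvPolynomial p z trivial).differentiableAt

lemma eval_rename_proj (q : MvPolynomial (Fin l) ℂ) (z : Fin n → ℂ) :
    eval z (rename J q) = eval (proj J z) q :=
  eval_rename _ _ _

lemma eval_killCompl (p : MvPolynomial (Fin n) ℂ) (ζ : Fin l → ℂ) :
    eval ζ (killCompl J.injective p) = eval (incl ℂ J ζ) p := by
  suffices h : (aeval ζ).comp (killCompl J.injective) = aeval (R := ℂ) (incl ℂ J ζ) from
    DFunLike.congr_fun h p
  refine algHom_ext fun k => ?_
  rw [AlgHom.comp_apply, aeval_X, killCompl, aeval_X]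
  split_ifs with hk
  · obtain ⟨i, rfl⟩ := hk
    simp [incl_apply]
  · rw [map_zero, incl_apply_of_notMem_range ζ hk]

lemma incl_natCast (α : Fin l →₀ ℕ) :
    incl ℝ J (fun i => (α i : ℝ)) = fun k => ((α.mapDomain J k : ℕ) : ℝ) :=
  incl_eq_of_mem_coordSubspace
    (fun _ hk => Nat.cast_eq_zero.mpr (Finsupp.mapDomain_of_notMem_range _ _ hk))
    fun i => by rw [Finsupp.mapDomain_apply J.injective]

lemma natCast_mem_smul_face_iff {m : ℕ} (h : m ≠ 0 ∨ (face J S).Nonempty) (α : Fin l →₀ ℕ) :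
    (fun i => (α i : ℝ)) ∈ (m : ℝ) • face J S ↔
      (fun k => ((α.mapDomain J k : ℕ) : ℝ)) ∈ (m : ℝ) • S := by
  rw [mem_smul_face_iff (h.imp_left Nat.cast_ne_zero.mpr), incl_natCast]

lemma killCompl_mem_polySpace {m : ℕ} (h : m ≠ 0 ∨ (face J S).Nonempty)
    {p : MvPolynomial (Fin n) ℂ} (hp : p ∈ polySpace S m) :
    killCompl J.injective p ∈ polySpace (face J S) m := by
  intro α hα
  rw [mem_support_iff, coeff_killCompl, ← mem_support_iff] at hα
  exact (natCast_mem_smul_face_iff h α).mpr (hp _ hα)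

lemma rename_mem_polySpace {m : ℕ} (h : m ≠ 0 ∨ (face J S).Nonempty)
    {q : MvPolynomial (Fin l) ℂ} (hq : q ∈ polySpace (face J S) m) :
    rename J q ∈ polySpace S m := by
  classical
  intro α hα
  rw [support_rename_of_injective J.injective, Finset.mem_image] at hα
  obtain ⟨β, hβ, rfl⟩ := hα
  exact (natCast_mem_smul_face_iff h β).mp (hq β hβ)

lemma enorm_eval_le_supNormOn {w : Fin n → ℂ} (hw : w ∈ K) (p : MvPolynomial (Fin n) ℂ) :
    ‖eval w p‖ₑ ≤ supNormOn K p :=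
  le_iSup₂_of_le (f := fun w (_ : w ∈ K) => ‖eval w p‖ₑ) w hw le_rfl

lemma supNormOn_rename (q : MvPolynomial (Fin l) ℂ) :
    supNormOn K (rename J q) = supNormOn (proj J '' K) q := by
  simp only [supNormOn, iSup_image, eval_rename_proj]

lemma supNormOn_killCompl_le (hK : IsReinhardt K) (p : MvPolynomial (Fin n) ℂ) :
    supNormOn (proj J '' K) (killCompl J.injective p) ≤ supNormOn K p := by
  refine iSup₂_le (Set.forall_mem_image.mpr fun w hw => ?_)
  rw [eval_killCompl]
  exact enorm_apply_le_of_circle (differentiable_eval p) fun c hc =>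
    enorm_eval_le_supNormOn (hK.incl_proj_add_smul_mem hw hc) p

lemma le_siciakFunOf {m : ℕ} {p : MvPolynomial (Fin n) ℂ} (hp : p ∈ polySpace S m)
    (hpK : supNormOn K p ≤ 1) (z : Fin n → ℂ) :
    ‖eval z p‖ₑ ^ (1 / (m : ℝ)) ≤ siciakFunOf S K m z :=
  le_iSup₂_of_le (f := fun p (_ : p ∈ {p | p ∈ polySpace S m ∧ supNormOn K p ≤ 1}) =>
    ‖eval z p‖ₑ ^ (1 / (m : ℝ))) p ⟨hp, hpK⟩ le_rfl

lemma siciakFunOf_incl (hK : IsReinhardt K) {m : ℕ} (hm : m ≠ 0) (ζ : Fin l → ℂ) :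
    siciakFunOf S K m (incl ℂ J ζ) = siciakFunOf (face J S) (proj J '' K) m ζ := by
  refine le_antisymm (iSup₂_le fun p ⟨hp, hpK⟩ => ?_) (iSup₂_le fun q ⟨hq, hqK⟩ => ?_)
  · rw [← eval_killCompl]
    exact le_siciakFunOf (killCompl_mem_polySpace (.inl hm) hp)
      ((supNormOn_killCompl_le hK p).trans hpK) ζ
  · have h := le_siciakFunOf (rename_mem_polySpace (.inl hm) hq)
      ((supNormOn_rename q).trans_le hqK) (incl ℂ J ζ)
    rwa [eval_rename_proj, proj_incl] at h

theorem siciakFun_incl (hK : IsReinhardt K) (ζ : Fin l → ℂ) :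
    siciakFun S K (incl ℂ J ζ) = siciakFun (face J S) (proj J '' K) ζ :=
  iSup_congr fun _ => iSup_congr fun hm => siciakFunOf_incl hK (Nat.one_le_iff_ne_zero.mp hm) ζ

theorem preimage_incl_hull (hS : (face J S).Nonempty) (hK : IsReinhardt K) :
    incl ℂ J ⁻¹' hull S K = hull (face J S) (proj J '' K) := by
  ext ζ
  simp only [hull, Set.mem_preimage, Set.mem_ofPred_eq, Set.mem_iUnion, forall_exists_index]
  constructor
  · intro hζ q m hq
    have h := hζ (rename J q) m (rename_mem_polySpace (.inr hS) hq)
    rwa [eval_rename_proj, proj_incl, supNormOn_rename] at h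
  · intro hζ p m hp
    rw [← eval_killCompl]
    exact (hζ _ m (killCompl_mem_polySpace (.inr hS) hp)).trans (supNormOn_killCompl_le hK p)

end Polynomial

end SiciakZakharyuta

open SiciakZakharyuta in
theorem proposition3p5_general (n l : ℕ) (J : Fin l ↪ Fin n)
    (S : Set (Fin n → ℝ)) (hS_compact : IsCompact S) (hS_nonneg : ∀ s ∈ S, ∀ i, 0 ≤ s i)
    (hS_face : (face J S).Nonempty) (K : Set (Fin n → ℂ)) (hK_reinhardt : IsReinhardt K) :
    (∀ z ∈ coordSubspace ℂ J,
      extremalFun S K z = extremalFun (face J S) (proj J '' K) (proj J z) ∧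
        siciakFun S K z = siciakFun (face J S) (proj J '' K) (proj J z)) ∧
      proj J '' (hull S K ∩ coordSubspace ℂ J) = hull (face J S) (proj J '' K) := by
  refine ⟨fun z hz => ?_, ?_⟩
  · obtain ⟨ζ, rfl⟩ : ∃ ζ, incl ℂ J ζ = z := ⟨proj J z, incl_proj hz⟩
    rw [proj_incl]
    exact ⟨extremalFun_incl hS_compact hS_nonneg hK_reinhardt ζ, siciakFun_incl hK_reinhardt ζ⟩
  · rw [image_proj_inter_coordSubspace, preimage_incl_hull hS_face hK_reinhardt]

theorem proposition3p5 (n l : ℕ) (J : Fin l ↪ Fin n)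
    (S : Set (Fin n → ℝ)) (hS_compact : IsCompact S) (hS_convex : Convex ℝ S)
    (hS_nonneg : ∀ s ∈ S, ∀ i, 0 ≤ s i) (hS_zero : (0 : Fin n → ℝ) ∈ S)
    (K : Set (Fin n → ℂ)) (hK_compact : IsCompact K)
    (hK_reinhardt : SiciakZakharyuta.IsReinhardt K) :
    (∀ z ∈ SiciakZakharyuta.coordSubspace ℂ J,
      SiciakZakharyuta.extremalFun S K z =
          SiciakZakharyuta.extremalFun (SiciakZakharyuta.face J S)
            (SiciakZakharyuta.proj J '' K) (SiciakZakharyuta.proj J z) ∧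
        SiciakZakharyuta.siciakFun S K z =
          SiciakZakharyuta.siciakFun (SiciakZakharyuta.face J S)
            (SiciakZakharyuta.proj J '' K) (SiciakZakharyuta.proj J z)) ∧
      SiciakZakharyuta.proj J '' (SiciakZakharyuta.hull S K ∩ SiciakZakharyuta.coordSubspace ℂ J) =
        SiciakZakharyuta.hull (SiciakZakharyuta.face J S) (SiciakZakharyuta.proj J '' K) :=
  proposition3p5_general n l J S hS_compact hS_nonneg ⟨0, 0, ⟨hS_zero, fun _ _ => rfl⟩, rfl⟩
    K hK_reinhardt
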